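/- Let $s\ge 1$ and let $\mathbf M$ be an irreducible $s\times s$ matrix with entries in $\{0,1\}$. Put $$\Sigma=\{\mathbf x=(x_0,x_1,\dots)\mid \mathbf M(x_j,x_{j+1})=1\ \forall j\ge 0\},\qquad \Sigma^*=\{\mathbf y=(\dots,y_2,y_1)\mid \mathbf M(y_{j+1},y_j)=1\ \forall j\ge 1\},$$ sequences of symbols in $\{1,\dots,s\}$, and let $$\hat\Sigma=\{(\mathbf y,\mathbf x)\in\Sigma^*\times\Sigma\mid \mathbf M(y_1,x_0)=1\}$$ be the natural extension of the one-sided transitive subshift of finite type $\Sigma$. Let $\pi:\hat\Sigma\to\Sigma$, $\pi(\mathbf y,\mathbf x)=\mathbf x$, and $\tau:\hat\Sigma\to\Sigma$, $\tau(\mathbf y,\mathbf x)=\tau_{\mathbf y}(\mathbf x)=(y_1,x_0,x_1,\dots)$. Fix $\lambda\in(0,1)$ and $\theta>0$; the distance $d$ of two distinct sequences is $\lambda^k$, where $k$ counts the symbols before the first position at which they differ (starting from $x_0$ in $\Sigma$ and from $y_1$ in $\Sigma^*$), and $\hat\Sigma$ carries the maximum of the distances of the two components. A real function $f$ is $\theta$-Hölder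 if $|f(p)-f(q)|\le C\,d(p,q)^\theta$ for some constant $C$ and all $p,q$. A Borel probability measure $\hat\mu$ on $\hat\Sigma$ is holonomic if $\int f\circ\tau\,d\hat\mu=\int f\circ\pi\,d\hat\mu$ for all $f\in C^0(\Sigma)$. Let $A:\hat\Sigma\to\mathbb R$ be $\theta$-Hölder and let $\bar A$ be the minimum of $\int A\,d\hat\mu$ over all holonomic probability measures $\hat\mu$. A sub-action for $A$ is a continuous function $u:\Sigma\to\mathbb R$ with $$u(\mathbf x)-u(\tau_{\mathbf y}(\mathbf x))\le A(\mathbf y,\mathbf x)-\bar A\qquad\forall(\mathbf y,\mathbf x)\in\hat\Sigma,$$ and its contact locus $\hat{\mathbb M}_A(u)\subset\hat\Sigma$ is the set of points $(\mathbf y,\mathbf x)$ where equality holds. A path of length $k$ is a sequence $(\mathbf z^0,\dots,\mathbf z^k)$ in $\hat\Sigma$ with $\pi(\mathbf z^i)=\tau(\mathbf z^{i+1})$ for $0\le i<k$. The $A$-non-wandering set $\Omega(A)$ is the set of $\mathbf x\in\Sigma$ such that for every $\epsilon>0$ there are $k\ge 1$ and a path $(\mathbf z^0,\dots,\mathbf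 z^k)$ with $d(\pi(\mathbf z^0),\mathbf x)<\epsilon$, $d(\pi(\mathbf z^k),\mathbf x)<\epsilon$ and $\bigl|\sum_{i=1}^k (A-\bar A)(\mathbf z^i)\bigr|<\epsilon$. A sub-action $u$ is separating if $\pi(\hat{\mathbb M}_A(u))=\Omega(A)$. **Theorem.** For every $\theta$-Hölder observable $A:\hat\Sigma\to\mathbb R$ there exists a $\theta$-Hölder separating sub-action. Moreover, in the topology of the norm $\|u\|_\theta=\sup|u|+\sup_{\mathbf x\ne\mathbf x'}|u(\mathbf x)-u(\mathbf x')|/d(\mathbf x,\mathbf x')^\theta$, the $\theta$-Hölder separating sub-actions form a residual subset of the space of all $\theta$-Hölder sub-actions, i.e. they contain a countable intersection of open dense subsets of that space. -/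

import Mathlib

open MeasureTheory Topology Filter
open scoped BigOperators

noncomputable section

namespace HolonomicModel

variable {s : ℕ}

/-- The one-sided subshift of finite type: sequences `x = (x_0, x_1, …)` with
`M (x_j) (x_{j+1}) = 1` for all `j ≥ 0`. It carries the topology induced by the product of
discrete topologies. -/
def sft (M : Matrix (Fin s) (Fin s) ℤ) : Set (ℕ → Fin s) :=
  {x | ∀ j, M (x j) (x (j + 1)) = 1}

/-- The dual subshift: sequences `y = (…, y_3, y_2, y_1)` with `M (y_{j+1}) (y_j) = 1` for
all `j ≥ 1`. The letter `y_{j+1}` is stored at index `j`. -/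
def dualSft (M : Matrix (Fin s) (Fin s) ℤ) : Set (ℕ → Fin s) :=
  {y | ∀ j, M (y (j + 1)) (y j) = 1}

/-- The natural extension: pairs `(y, x) = (…, y_2, y_1 | x_0, x_1, …)` with `y` in the dual
subshift, `x` in the subshift and `M (y_1) (x_0) = 1`. -/
def natExt (M : Matrix (Fin s) (Fin s) ℤ) : Set ((ℕ → Fin s) × (ℕ → Fin s)) :=
  {z | z.1 ∈ dualSft M ∧ z.2 ∈ sft M ∧ M (z.1 0) (z.2 0) = 1}

variable {M : Matrix (Fin s) (Fin s) ℤ}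

/-- The canonical projection `π (y, x) = x`. -/
def proj (z : natExt M) : sft M := ⟨z.1.2, z.2.2.1⟩

/-- The map `τ (y, x) = τ_y (x) = (y_1, x_0, x_1, …)`, an inverse branch of the shift. -/
def tau (z : natExt M) : sft M :=
  ⟨fun n => Nat.casesOn n (z.1.1 0) z.1.2, by
    intro j
    cases j with
    | zero => exact z.2.2.2
    | succ j => exact z.2.2.1 j⟩

open Classical in
/-- The distance `lam ^ k`, where `k` is the first index at which the two sequences differ
(and `0` if they are equal). -/
def seqDist (lam : ℝ) (x x' : ℕ → Fin s) : ℝ :=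
  if x = x' then 0 else lam ^ PiNat.firstDiff x x'

/-- The distance on the subshift. -/
def sftDist (lam : ℝ) (x x' : sft M) : ℝ := seqDist lam x.1 x'.1

/-- The (product) distance on the natural extension. -/
def extDist (lam : ℝ) (z z' : natExt M) : ℝ :=
  max (seqDist lam z.1.1 z'.1.1) (seqDist lam z.1.2 z'.1.2)

/-- `f` is `θ`-Hölder with respect to the distance `d`. -/
def IsHolder {X : Type*} (d : X → X → ℝ) (θ : ℝ) (f : X → ℝ) : Prop :=
  ∃ C : ℝ, ∀ x x', |f x - f x'| ≤ C * d x x' ^ θ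

/-- Holonomic probability measures on the natural extension: `∫ f ∘ τ = ∫ f ∘ π` for every
continuous `f` on the subshift. -/
def IsHolonomic (μ : Measure (natExt M)) : Prop :=
  IsProbabilityMeasure μ ∧ ∀ f : C(sft M, ℝ), ∫ z, f (tau z) ∂μ = ∫ z, f (proj z) ∂μ

/-- The holonomic minimizing value of `A`: the minimum of `∫ A dμ` over the holonomic
probability measures `μ`. -/
def minValue (A : natExt M → ℝ) : ℝ :=
  sInf {r : ℝ | ∃ μ : Measure (natExt M), IsHolonomic μ ∧ r = ∫ z, A z ∂μ}

/-- The continuous function `u` is a sub-action with respect to `A`. -/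
def IsSubaction (A : natExt M → ℝ) (u : C(sft M, ℝ)) : Prop :=
  ∀ z : natExt M, u (proj z) - u (tau z) ≤ A z - minValue A

/-- The contact locus of `u`. -/
def contactLocus (A : natExt M → ℝ) (u : C(sft M, ℝ)) : Set (natExt M) :=
  {z | u (proj z) - u (tau z) = A z - minValue A}

/-- Paths `(z^0, …, z^k)` of length `k`: with `z^i = (y^i, x^i)`, one has
`x^i = τ_{y^{i+1}} (x^{i+1})` for `0 ≤ i < k`. -/
def IsPath {k : ℕ} (z : Fin (k + 1) → natExt M) : Prop :=
  ∀ i : Fin k, proj (z i.castSucc) = tau (z i.succ)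

/-- The set `Ω(A)` of points of the subshift that are non-wandering with respect to `A`. -/
def nonWandering (lam : ℝ) (A : natExt M → ℝ) : Set (sft M) :=
  {x | ∀ ε : ℝ, 0 < ε → ∃ k : ℕ, 1 ≤ k ∧ ∃ z : Fin (k + 1) → natExt M,
    IsPath z ∧
    sftDist lam (proj (z 0)) x < ε ∧
    sftDist lam (proj (z (Fin.last k))) x < ε ∧
    |∑ i : Fin k, (A (z i.succ) - minValue A)| < ε}

/-- A separating sub-action: a continuous sub-action whose projected contact locus is `Ω(A)`. -/
def IsSeparating (lam : ℝ) (A : natExt M → ℝ) (u : C(sft M, ℝ)) : Prop :=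
  IsSubaction A u ∧ proj '' contactLocus A u = nonWandering lam A

theorem isClosed_sft (M : Matrix (Fin s) (Fin s) ℤ) : IsClosed (sft M) := by
  have h : sft M = ⋂ j : ℕ, (fun x : ℕ → Fin s => M (x j) (x (j + 1))) ⁻¹' {1} := by
    ext x
    simp [sft]
  rw [h]
  refine isClosed_iInter fun j => IsClosed.preimage ?_ isClosed_singleton
  have h2 : Continuous (fun p : Fin s × Fin s => M p.1 p.2) := continuous_of_discreteTopology
  exact h2.comp (g := fun p : Fin s × Fin s => M p.1 p.2)
    (f := fun x : ℕ → Fin s => (x j, x (j + 1)))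
    ((continuous_apply j).prodMk (continuous_apply (j + 1)))

instance : CompactSpace (sft M) := isCompact_iff_compactSpace.mp (isClosed_sft M).isCompact

/-- The `θ`-Hölder seminorm `sup |f x - f x'| / d(x, x')^θ` (the pairs `x = x'` contribute
`0`). -/
def holderSeminorm (lam θ : ℝ) (f : C(sft M, ℝ)) : ℝ :=
  ⨆ p : sft M × sft M, |f p.1 - f p.2| / sftDist lam p.1 p.2 ^ θ

theorem bddAbove_holder {lam θ : ℝ} {f : C(sft M, ℝ)} (hf : IsHolder (sftDist lam) θ f) :
    BddAbove (Set.range fun p : sft M × sft M =>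
      |f p.1 - f p.2| / sftDist lam p.1 p.2 ^ θ) := by
  obtain ⟨C, hC⟩ := hf
  refine ⟨|C|, ?_⟩
  rintro _ ⟨p, rfl⟩
  rcases le_or_gt (sftDist lam p.1 p.2 ^ θ) 0 with h | h
  · exact (div_nonpos_of_nonneg_of_nonpos (abs_nonneg _) h).trans (abs_nonneg _)
  · exact ((div_le_iff₀ h).2 (hC _ _)).trans (le_abs_self _)

theorem IsHolder.sub {X : Type*} {d : X → X → ℝ} {θ : ℝ} {f g : X → ℝ}
    (hf : IsHolder d θ f) (hg : IsHolder d θ g) : IsHolder d θ (fun x => f x - g x) := by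
  obtain ⟨C, hC⟩ := hf
  obtain ⟨D, hD⟩ := hg
  refine ⟨C + D, fun x x' => ?_⟩
  have h1 := hC x x'
  have h2 := hD x x'
  have h3 := abs_sub (f x - f x') (g x - g x')
  have h4 : f x - g x - (f x' - g x') = f x - f x' - (g x - g x') := by ring
  rw [h4, add_mul]
  linarith

theorem holderSeminorm_nonneg {lam θ : ℝ} {f : C(sft M, ℝ)}
    (hf : IsHolder (sftDist lam) θ f) : 0 ≤ holderSeminorm lam θ f := by
  rcases isEmpty_or_nonempty (sft M) with h | ⟨⟨x⟩⟩
  · simp [holderSeminorm]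
  · have := le_ciSup (bddAbove_holder hf) (x, x)
    simpa [holderSeminorm] using this

theorem abs_div_le_holderSeminorm {lam θ : ℝ} {f : C(sft M, ℝ)}
    (hf : IsHolder (sftDist lam) θ f) (p : sft M × sft M) :
    |f p.1 - f p.2| / sftDist lam p.1 p.2 ^ θ ≤ holderSeminorm lam θ f :=
  le_ciSup (bddAbove_holder hf) p

theorem sftDist_nonneg {lam : ℝ} (h : 0 < lam) (x x' : sft M) : 0 ≤ sftDist lam x x' := by
  unfold sftDist seqDist
  split_ifs
  · exact le_rfl
  · positivity

/-- The `θ`-Hölder sub-actions of `A`; the parameter `lam` of the distance is a real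
number in `(0, 1)`. -/
structure HolderSubaction (lam : Set.Ioo (0 : ℝ) 1) (θ : ℝ) (A : natExt M → ℝ) where
  /-- the underlying continuous function -/
  fn : C(sft M, ℝ)
  isHolder : IsHolder (sftDist lam.1) θ fn
  isSubaction : IsSubaction A fn

/-- The `θ`-Hölder topology on the `θ`-Hölder sub-actions: the one of the distance
`‖u - v‖_θ`, where `‖f‖_θ = sup |f| + sup |f x - f x'| / d(x, x')^θ`. -/
instance (lam : Set.Ioo (0 : ℝ) 1) (θ : ℝ) (A : natExt M → ℝ) :
    MetricSpace (HolderSubaction lam θ A) where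
  dist u v := ‖u.fn - v.fn‖ + holderSeminorm lam.1 θ (u.fn - v.fn)
  dist_self u := by simp [holderSeminorm]
  dist_comm u v := by
    rw [norm_sub_rev]
    congr 1
    unfold holderSeminorm
    congr 1
    ext p
    congr 1
    rw [← abs_neg]
    congr 1
    simp only [ContinuousMap.sub_apply]
    ring
  dist_triangle u v w := by
    have huv := u.isHolder.sub v.isHolder
    have hvw := v.isHolder.sub w.isHolder
    have h1 := norm_sub_le_norm_sub_add_norm_sub u.fn v.fn w.fn
    have h2 : holderSeminorm lam.1 θ (u.fn - w.fn) ≤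
        holderSeminorm lam.1 θ (u.fn - v.fn) + holderSeminorm lam.1 θ (v.fn - w.fn) := by
      refine Real.iSup_le (fun p => ?_)
        (add_nonneg (holderSeminorm_nonneg huv) (holderSeminorm_nonneg hvw))
      refine le_trans ?_ (add_le_add (abs_div_le_holderSeminorm huv p)
        (abs_div_le_holderSeminorm hvw p))
      rw [← add_div]
      refine div_le_div_of_nonneg_right ?_
        (Real.rpow_nonneg (sftDist_nonneg lam.2.1 _ _) _)
      refine le_trans (le_of_eq ?_) (abs_add_le _ _)
      congr 1
      simp only [ContinuousMap.sub_apply]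
      ring
    linarith
  eq_of_dist_eq_zero {u v} h := by
    have h1 := holderSeminorm_nonneg (f := u.fn - v.fn) (u.isHolder.sub v.isHolder)
    have h2 := norm_nonneg (u.fn - v.fn)
    have h3 : ‖u.fn - v.fn‖ = 0 := by
      change ‖u.fn - v.fn‖ + holderSeminorm lam.1 θ (u.fn - v.fn) = 0 at h
      linarith
    have h4 : u.fn = v.fn := sub_eq_zero.1 (norm_eq_zero.1 h3)
    cases u
    cases v
    simpa using h4

end HolonomicModel

end

/-! Put c = A - `minValue A` and view z as an arrow from `tau z` to `proj z` of cost c z, so that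
paths follow the shift. The uniform measure on the arrows of a loop is holonomic, hence loops have
nonnegative cost. By irreducibility every path can be closed up by a connecting word of bounded
length; since inverse branches contract and c is Hölder, the closing changes the cost by a bounded
amount (`Reach.shadow`). So the costs of all paths have a common lower bound
(`exists_forall_neg_le_reach`). For Hölder f, the infimum of f(a) + r over paths from a to b of cost
r is therefore finite; as a function of b it is the largest sub-action below f, and it is Hölder
(`exists_envelope`). The choice f = 0 gives a sub-action v.

Every sub-action has contact points over Ω(A): along an almost closed path of almost zero cost the
last arrow has almost no defect, and compactness yields a contact in the limit. If x is outside
Ω(A), then on a small cylinder W around x every return costs at least the variation of v plus some h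
> 0. The envelope of v lowered by h on W then has no contact over W
(`exists_strict_of_returnsCostly`).

There are only countably many cylinders. Having no contact over W is an open condition by
compactness, and a dense one because mixing in a strict sub-action makes any sub-action strict. The
intersection of these conditions over the relevant cylinders consists of separating sub-actions. A
point of this intersection is built as a weighted series (`exists_forall_mem_strictOver`), so
neither completeness nor the Baire theorem is needed. -/

noncomputable section

namespace HolonomicModel

/-! ### Distances, contraction of inverse branches, continuity of Hölder functions. -/

section Distance

variable {s : ℕ} {M : Matrix (Fin s) (Fin s) ℤ} {lam : ℝ}

theorem seqDist_nonneg (h0 : 0 < lam) (x x' : ℕ → Fin s) : 0 ≤ seqDist lam x x' := by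
  unfold seqDist
  split_ifs
  · exact le_rfl
  · positivity

theorem seqDist_le_one (h0 : 0 < lam) (h1 : lam < 1) (x x' : ℕ → Fin s) :
    seqDist lam x x' ≤ 1 := by
  unfold seqDist
  split_ifs
  · exact zero_le_one
  · exact pow_le_one₀ h0.le h1.le

theorem seqDist_self (x : ℕ → Fin s) : seqDist lam x x = 0 := by simp [seqDist]

theorem seqDist_comm (x x' : ℕ → Fin s) : seqDist lam x x' = seqDist lam x' x := by
  by_cases h : x = x'
  · rw [h]
  · simp [seqDist, h, Ne.symm h, PiNat.firstDiff_comm x x']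

theorem seqDist_le_pow (h0 : 0 < lam) (h1 : lam < 1) {x x' : ℕ → Fin s} {n : ℕ}
    (h : ∀ j < n, x j = x' j) : seqDist lam x x' ≤ lam ^ n := by
  unfold seqDist
  split_ifs with hx
  · positivity
  · refine pow_le_pow_of_le_one h0.le h1.le ?_
    by_contra! hlt
    exact PiNat.apply_firstDiff_ne hx (h _ hlt)

theorem eq_of_seqDist_lt_pow (h0 : 0 < lam) (h1 : lam < 1) {x x' : ℕ → Fin s} {n : ℕ}
    (h : seqDist lam x x' < lam ^ n) {j : ℕ} (hj : j < n) : x j = x' j := by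
  unfold seqDist at h
  split_ifs at h with hx
  · rw [hx]
  · have := (pow_lt_pow_iff_right_of_lt_one₀ h0 h1).1 h
    exact PiNat.apply_eq_of_lt_firstDiff (hj.trans this)

theorem seqDist_eq_one {x x' : ℕ → Fin s} (h : x 0 ≠ x' 0) : seqDist lam x x' = 1 := by
  have hx : x ≠ x' := fun e => h (by rw [e])
  have : PiNat.firstDiff x x' = 0 := by
    by_contra h'
    exact h (PiNat.apply_eq_of_lt_firstDiff (Nat.pos_of_ne_zero h'))
  simp [seqDist, hx, this]

theorem seqDist_ge_pow (h0 : 0 < lam) (h1 : lam < 1) {x x' : ℕ → Fin s} {n : ℕ}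
    (h : ∃ j < n, x j ≠ x' j) : lam ^ n ≤ seqDist lam x x' := by
  by_contra! hlt
  obtain ⟨j, hj, hne⟩ := h
  exact hne (eq_of_seqDist_lt_pow h0 h1 hlt hj)

theorem sftDist_le_one (h0 : 0 < lam) (h1 : lam < 1) (x x' : sft M) : sftDist lam x x' ≤ 1 :=
  seqDist_le_one h0 h1 _ _

theorem sftDist_comm (x x' : sft M) : sftDist lam x x' = sftDist lam x' x := seqDist_comm _ _

theorem extDist_nonneg (h0 : 0 < lam) (z z' : natExt M) : 0 ≤ extDist lam z z' :=
  (seqDist_nonneg h0 _ _).trans (le_max_left _ _)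

/-- Two inverse branches along the same past contract distances by `lam`. -/
theorem sftDist_tau_le (h0 : 0 < lam) (h1 : lam < 1) {z z' : natExt M}
    (h : z.1.1 0 = z'.1.1 0) :
    sftDist lam (tau z) (tau z') ≤ lam * sftDist lam (proj z) (proj z') := by
  by_cases hx : z.1.2 = z'.1.2
  · have ht : tau z = tau z' := by
      apply Subtype.ext
      funext n
      cases n with
      | zero => exact h
      | succ n => exact congrFun hx n
    simp [ht, sftDist, seqDist, proj, hx]
  · have h2 : sftDist lam (proj z) (proj z') = lam ^ PiNat.firstDiff z.1.2 z'.1.2 := by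
      simp [sftDist, seqDist, proj, hx]
    rw [h2, ← pow_succ']
    refine seqDist_le_pow h0 h1 fun j hj => ?_
    cases j with
    | zero => exact h
    | succ j =>
      have hj' : j < PiNat.firstDiff z.1.2 z'.1.2 := Nat.lt_of_succ_lt_succ hj
      have hz : z.1.2 j = z'.1.2 j := PiNat.apply_eq_of_lt_firstDiff hj'
      exact hz

theorem continuous_proj : Continuous (proj : natExt M → sft M) :=
  Continuous.subtype_mk (continuous_snd.comp continuous_subtype_val) _

theorem continuous_tau : Continuous (tau : natExt M → sft M) := by
  refine Continuous.subtype_mk (continuous_pi fun n => ?_) _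
  cases n with
  | zero => exact (continuous_apply 0).comp (continuous_fst.comp continuous_subtype_val)
  | succ n => exact (continuous_apply n).comp (continuous_snd.comp continuous_subtype_val)

theorem isClosed_natExt (M : Matrix (Fin s) (Fin s) ℤ) : IsClosed (natExt M) := by
  have hd (p : (ℕ → Fin s) × (ℕ → Fin s) → Fin s × Fin s) (hp : Continuous p) :
      IsClosed {z | M (p z).1 (p z).2 = 1} := by
    have h2 : Continuous (fun p : Fin s × Fin s => M p.1 p.2) := continuous_of_discreteTopology
    exact isClosed_eq (h2.comp hp) continuous_const
  have h : natExt M = (⋂ j : ℕ, {z | M (z.1 (j + 1)) (z.1 j) = 1}) ∩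
      ((⋂ j : ℕ, {z | M (z.2 j) (z.2 (j + 1)) = 1}) ∩ {z | M (z.1 0) (z.2 0) = 1}) := by
    ext z
    simp [natExt, dualSft, sft]
  rw [h]
  exact (isClosed_iInter fun j => hd (fun z => (z.1 (j + 1), z.1 j)) (by fun_prop)).inter
    ((isClosed_iInter fun j => hd (fun z => (z.2 j, z.2 (j + 1))) (by fun_prop)).inter
      (hd (fun z => (z.1 0, z.2 0)) (by fun_prop)))

instance : CompactSpace (natExt M) :=
  isCompact_iff_compactSpace.mp (isClosed_natExt M).isCompact

theorem eventually_agree (x : ℕ → Fin s) (n : ℕ) : ∀ᶠ x' in 𝓝 x, ∀ j < n, x' j = x j := by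
  have := (PiNat.isOpen_cylinder (E := fun _ => Fin s) x n).mem_nhds
    (PiNat.self_mem_cylinder x n)
  filter_upwards [this] with x' hx' j hj
  exact hx' j hj

theorem eventually_pow_rpow_lt (h0 : 0 < lam) (h1 : lam < 1) {θ : ℝ} (hθ : 0 < θ) (C : ℝ)
    {ε : ℝ} (hε : 0 < ε) : ∀ᶠ n : ℕ in atTop, C * (lam ^ n) ^ θ < ε := by
  have h : Tendsto (fun n : ℕ => C * (lam ^ n) ^ θ) atTop (𝓝 (C * 0 ^ θ)) :=
    ((tendsto_pow_atTop_nhds_zero_of_lt_one h0.le h1).rpow_const (Or.inr hθ.le)).const_mul C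
  rw [Real.zero_rpow hθ.ne', mul_zero] at h
  exact h.eventually_lt_const hε

/-- A Hölder function is continuous, for any distance whose small balls are neighbourhoods. -/
theorem IsHolder.continuous {X : Type*} [TopologicalSpace X] {d : X → X → ℝ}
    (h0 : 0 < lam) (h1 : lam < 1) {θ : ℝ} (hθ : 0 < θ) (hd0 : ∀ x x', 0 ≤ d x x')
    (hd : ∀ x n, ∀ᶠ x' in 𝓝 x, d x' x ≤ lam ^ n) {f : X → ℝ} (hf : IsHolder d θ f) :
    Continuous f := by
  obtain ⟨C, hC⟩ := hf
  refine continuous_iff_continuousAt.2 fun x => Metric.tendsto_nhds.2 fun ε hε => ?_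
  obtain ⟨n, hn⟩ := (eventually_pow_rpow_lt h0 h1 hθ |C| hε).exists
  filter_upwards [hd x n] with x' hx'
  rw [Real.dist_eq]
  refine lt_of_le_of_lt ((hC x' x).trans ?_) hn
  have := hd0 x' x
  gcongr
  exact le_abs_self C

theorem IsHolder.continuous_sft (h0 : 0 < lam) (h1 : lam < 1) {θ : ℝ} (hθ : 0 < θ)
    {f : sft M → ℝ} (hf : IsHolder (sftDist lam) θ f) : Continuous f := by
  refine hf.continuous h0 h1 hθ (sftDist_nonneg h0) fun x n => ?_
  filter_upwards [continuous_subtype_val.continuousAt.eventually (eventually_agree x.1 n)]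
    with x' hx'
  exact seqDist_le_pow h0 h1 hx'

theorem IsHolder.continuous_natExt (h0 : 0 < lam) (h1 : lam < 1) {θ : ℝ} (hθ : 0 < θ)
    {f : natExt M → ℝ} (hf : IsHolder (extDist lam) θ f) : Continuous f := by
  refine hf.continuous h0 h1 hθ (extDist_nonneg h0) fun z n => ?_
  filter_upwards [(continuous_fst.comp continuous_subtype_val).continuousAt.eventually
      (eventually_agree z.1.1 n),
    (continuous_snd.comp continuous_subtype_val).continuousAt.eventually
      (eventually_agree z.1.2 n)] with z' h h'
  exact max_le (seqDist_le_pow h0 h1 h) (seqDist_le_pow h0 h1 h')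

end Distance

/-! ### Irreducibility: connecting words and periodic points. -/

section Chains

variable {s : ℕ} {M : Matrix (Fin s) (Fin s) ℤ}

theorem exists_chain (hM01 : ∀ i j, M i j = 0 ∨ M i j = 1) (hMirr : M.IsIrreducible)
    (i j : Fin s) : ∃ p : ℕ, 1 ≤ p ∧ ∃ e : ℕ → Fin s, e 0 = i ∧ e p = j ∧
      ∀ k < p, M (e k) (e (k + 1)) = 1 := by
  let : Quiver (Fin s) := M.toQuiver
  have key (l : Fin s) (q : Quiver.Path i l) : ∃ e : ℕ → Fin s, e 0 = i ∧ e q.length = l ∧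
      ∀ k < q.length, M (e k) (e (k + 1)) = 1 := by
    induction q with
    | nil => exact ⟨fun _ => i, rfl, rfl, fun k hk => by simp at hk⟩
    | @cons b c q g ih =>
      obtain ⟨e, h0, h1, h2⟩ := ih
      refine ⟨fun k => if k ≤ q.length then e k else c, by simp [h0], by simp, fun k hk => ?_⟩
      have hk' : k ≤ q.length := by simpa [Nat.lt_succ_iff] using hk
      rcases hk'.lt_or_eq with hlt | heq
      · have hlt' : k + 1 ≤ q.length := hlt
        simp only [hk', hlt', if_true]
        exact h2 k hlt
      · have hg : 0 < M b c := g.down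
        have : M b c = 1 := (hM01 b c).resolve_left hg.ne'
        simp [heq, h1, this]
  obtain ⟨q, hq⟩ := hMirr.connected i j
  exact ⟨q.length, hq, key j q⟩

/-- The alphabet is finite, so the maximum of the lengths chosen for the pairs of letters serves as
P. -/
theorem exists_chain_bounded (hM01 : ∀ i j, M i j = 0 ∨ M i j = 1) (hMirr : M.IsIrreducible) :
    ∃ P : ℕ, ∀ i j : Fin s, ∃ p : ℕ, 1 ≤ p ∧ p ≤ P ∧ ∃ e : ℕ → Fin s, e 0 = i ∧ e p = j ∧
      ∀ k < p, M (e k) (e (k + 1)) = 1 := by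
  choose p hp he using exists_chain hM01 hMirr
  refine ⟨Finset.univ.sup fun ij : Fin s × Fin s => p ij.1 ij.2, fun i j =>
    ⟨p i j, hp i j, ?_, he i j⟩⟩
  exact Finset.le_sup (f := fun ij : Fin s × Fin s => p ij.1 ij.2) (Finset.mem_univ (i, j))

theorem exists_dual_ending (hM01 : ∀ i j, M i j = 0 ∨ M i j = 1) (hMirr : M.IsIrreducible)
    (i : Fin s) : ∃ y ∈ dualSft M, y 0 = i := by
  have hpred (i : Fin s) : ∃ l, M l i = 1 := by
    obtain ⟨p, hp, e, -, h1, h2⟩ := exists_chain hM01 hMirr i i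
    obtain ⟨p, rfl⟩ := Nat.exists_eq_succ_of_ne_zero (Nat.one_le_iff_ne_zero.1 hp)
    exact ⟨e p, h1 ▸ h2 p (Nat.lt_succ_self p)⟩
  choose pred hpred using hpred
  refine ⟨fun j => pred^[j] i, fun j => ?_, rfl⟩
  change M (pred^[j + 1] i) (pred^[j] i) = 1
  rw [Function.iterate_succ_apply']
  exact hpred _

theorem proj_surjective (hM01 : ∀ i j, M i j = 0 ∨ M i j = 1) (hMirr : M.IsIrreducible) :
    Function.Surjective (proj : natExt M → sft M) := by
  intro x
  obtain ⟨p, hp, e, -, h1, h2⟩ := exists_chain hM01 hMirr (x.1 0) (x.1 0)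
  obtain ⟨p, rfl⟩ := Nat.exists_eq_succ_of_ne_zero (Nat.one_le_iff_ne_zero.1 hp)
  obtain ⟨y, hy, hy0⟩ := exists_dual_ending hM01 hMirr (e p)
  exact ⟨⟨(y, x.1), hy, x.2, by simpa [hy0, ← h1] using h2 p (Nat.lt_succ_self p)⟩, rfl⟩

/-- The shift on the subshift of finite type. -/
def shift (x : sft M) : sft M := ⟨fun n => x.1 (n + 1), fun j => x.2 (j + 1)⟩

theorem exists_tau_eq (hM01 : ∀ i j, M i j = 0 ∨ M i j = 1) (hMirr : M.IsIrreducible)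
    (x : sft M) : ∃ z : natExt M, tau z = x ∧ proj z = shift x := by
  obtain ⟨y, hy, hy0⟩ := exists_dual_ending hM01 hMirr (x.1 0)
  refine ⟨⟨(y, (shift x).1), hy, (shift x).2, ?_⟩, ?_, rfl⟩
  · change M (y 0) (x.1 1) = 1
    rw [hy0]
    exact x.2 0
  apply Subtype.ext
  funext n
  cases n with
  | zero => exact hy0
  | succ n => rfl

/-- An admissible word can be closed up to a periodic point, by a connecting word of bounded
length. -/
theorem exists_periodic (hM01 : ∀ i j, M i j = 0 ∨ M i j = 1) (hMirr : M.IsIrreducible) :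
    ∃ P : ℕ, ∀ (a : sft M) (n : ℕ), ∃ p : ℕ, 1 ≤ p ∧ p ≤ P ∧ ∃ x : sft M,
      (∀ j ≤ n, x.1 j = a.1 j) ∧ ∀ j, x.1 (j + (n + p)) = x.1 j := by
  obtain ⟨P, hP⟩ := exists_chain_bounded hM01 hMirr
  refine ⟨P, fun a n => ?_⟩
  obtain ⟨p, hp1, hpP, e, he0, hep, he⟩ := hP (a.1 n) (a.1 0)
  set w : ℕ → Fin s := fun k => if k < n then a.1 k else e (k - n) with hw
  have hwa : ∀ j ≤ n, w j = a.1 j := by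
    intro j hj
    rcases hj.lt_or_eq with h | h
    · simp [hw, h]
    · simp [hw, h, he0]
  have hw1 : ∀ k < n + p, M (w k) (w (k + 1)) = 1 := by
    intro k hk
    by_cases hkn : k < n
    · rw [hwa k hkn.le, hwa (k + 1) hkn]
      exact a.2 k
    · have h1 : ¬ k + 1 < n := by omega
      have h2 : k + 1 - n = k - n + 1 := by omega
      simp only [hw, hkn, h1, if_false, h2]
      exact he _ (by omega)
  have hw2 : w (n + p) = w 0 := by
    rw [hwa 0 (Nat.zero_le _)]
    simp [hw, hep]
  have hN : 0 < n + p := by omega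
  refine ⟨p, hp1, hpP, ⟨fun k => w (k % (n + p)), fun j => ?_⟩, fun j hj => ?_, fun j => ?_⟩
  · have hlt := Nat.mod_lt j hN
    change M (w (j % (n + p))) (w ((j + 1) % (n + p))) = 1
    rw [Nat.add_mod]
    -- Period one is separate because `1 % 1 = 0`; the word is then a single letter that may follow
    -- itself.
    by_cases h1 : n + p = 1
    · have h3 : j % (n + p) = 0 := by omega
      have h4 : (j % (n + p) + 1 % (n + p)) % (n + p) = 0 := by
        rw [h1, Nat.mod_one]
      rw [h4, h3, ← hw2, h1]
      have := hw1 0 hN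
      rw [← hw2, h1] at this
      exact this
    · rw [Nat.mod_eq_of_lt (a := 1) (by omega)]
      rcases (Nat.succ_le_of_lt hlt).lt_or_eq with h | h
      · rw [Nat.mod_eq_of_lt h]
        exact hw1 _ hlt
      · have h' : j % (n + p) + 1 = n + p := h
        have := hw1 _ hlt
        rw [h', hw2] at this
        rw [h', Nat.mod_self]
        exact this
  · change w (j % (n + p)) = _
    rw [Nat.mod_eq_of_lt (by omega)]
    exact hwa j hj
  · simp

end Chains

/-! ### Paths with costs, shadowing, and the lower bound on costs. -/

section Reach

variable {s : ℕ} {M : Matrix (Fin s) (Fin s) ℤ} {lam : ℝ}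

/-- `Reach c a b n r`: a path of length `n` leads from `a` to `b`, and `r` is the sum of the
cost `c` along it. -/
inductive Reach (c : natExt M → ℝ) (a : sft M) : sft M → ℕ → ℝ → Prop
  | nil : Reach c a a 0 0
  | cons {n : ℕ} {r : ℝ} (z : natExt M) (h : Reach c a (tau z) n r) :
      Reach c a (proj z) (n + 1) (r + c z)

variable {c : natExt M → ℝ}

theorem Reach.trans {a b d : sft M} {n m : ℕ} {r t : ℝ} (h : Reach c a b n r)
    (h' : Reach c b d m t) : Reach c a d (n + m) (r + t) := by
  induction h' with
  | nil => simpa using h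
  | cons z _ ih =>
    rw [← add_assoc, ← add_assoc]
    exact Reach.cons z ih

/-- Each arrow deletes the first letter, so the endpoint of a path is determined by its start and
its length; only the pasts, and hence the cost, remain free. -/
theorem Reach.apply_eq {a b : sft M} {n : ℕ} {r : ℝ} (h : Reach c a b n r) (j : ℕ) :
    b.1 j = a.1 (n + j) := by
  induction h generalizing j with
  | nil => simp
  | @cons n r z _ ih =>
    have := ih (j + 1)
    rw [add_assoc, add_comm 1 j, ← this]
    rfl

theorem Reach.exists_last {a b : sft M} {n : ℕ} {r : ℝ} (h : Reach c a b n r) (hn : 1 ≤ n) :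
    ∃ (z : natExt M) (m : ℕ) (t : ℝ), proj z = b ∧ Reach c a (tau z) m t ∧ t + c z = r := by
  cases h with
  | nil => omega
  | cons z h => exact ⟨z, _, _, rfl, h, rfl⟩

theorem Reach.le_add {u : sft M → ℝ} (hu : ∀ z, u (proj z) - u (tau z) ≤ c z)
    {a b : sft M} {n : ℕ} {r : ℝ} (h : Reach c a b n r) : u b ≤ u a + r := by
  induction h with
  | nil => simp
  | cons z _ ih => linarith [hu z]

theorem Reach.exists_seq (hs : Function.Surjective (proj : natExt M → sft M))
    {a b : sft M} {n : ℕ} {r : ℝ} (h : Reach c a b n r) :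
    ∃ z : ℕ → natExt M, proj (z 0) = a ∧ proj (z n) = b ∧
      (∀ i < n, proj (z i) = tau (z (i + 1))) ∧ r = ∑ i ∈ Finset.range n, c (z (i + 1)) := by
  induction h with
  | nil =>
    -- The initial point has an arbitrary past: its cost does not enter the sum, which starts at
    -- index 1.
    obtain ⟨z, hz⟩ := hs a
    exact ⟨fun _ => z, hz, hz, by simp, by simp⟩
  | @cons n r w _ ih =>
    obtain ⟨z, h0, hn, hz, hr⟩ := ih
    refine ⟨fun i => if i ≤ n then z i else w, by simpa using h0, by simp, fun i hi => ?_, ?_⟩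
    · rcases (Nat.lt_succ_iff.1 hi).lt_or_eq with h | h
      · have h' : i + 1 ≤ n := h
        simp only [h.le, h', if_true]
        exact hz i h
      · simp [h, hn]
    · rw [Finset.sum_range_succ, hr]
      congr 1
      · refine Finset.sum_congr rfl fun i hi => ?_
        have h' : i + 1 ≤ n := Finset.mem_range.1 hi
        simp [h']
      · simp

theorem IsPath.reach {k : ℕ} {z : Fin (k + 1) → natExt M} (hz : IsPath z) :
    Reach c (proj (z 0)) (proj (z (Fin.last k))) k (∑ i : Fin k, c (z i.succ)) := by
  induction k with
  | zero => simpa using Reach.nil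
  | succ k ih =>
    have h := ih (z := fun i => z i.castSucc) fun i => hz i.castSucc
    have hlast : proj (z (Fin.last k).castSucc) = tau (z (Fin.last (k + 1))) := hz (Fin.last k)
    rw [hlast] at h
    rw [Fin.sum_univ_castSucc]
    exact Reach.cons _ h

theorem exists_reach_shift (hs : ∀ x : sft M, ∃ z, tau z = x ∧ proj z = shift x) {B : ℝ}
    (hB : ∀ z, c z ≤ B) (x : sft M) (n : ℕ) : ∃ r, Reach c x (shift^[n] x) n r ∧ r ≤ n * B := by
  induction n with
  | zero => exact ⟨0, Reach.nil, by simp⟩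
  | succ n ih =>
    obtain ⟨r, hr, hrB⟩ := ih
    obtain ⟨z, hz, hz'⟩ := hs (shift^[n] x)
    refine ⟨r + c z, ?_, ?_⟩
    · rw [Function.iterate_succ_apply', ← hz']
      exact Reach.cons z (hz ▸ hr)
    · push_cast
      linarith [hB z]

theorem shift_iterate_apply (x : sft M) (n j : ℕ) : (shift^[n] x).1 j = x.1 (j + n) := by
  induction n generalizing j with
  | zero => rfl
  | succ n ih =>
    rw [Function.iterate_succ_apply']
    change (shift^[n] x).1 (j + 1) = _
    rw [ih, add_right_comm, add_assoc]

/-- Paths can be shadowed by paths ending at a nearby point, with nearly the same cost. -/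
theorem Reach.shadow (h0 : 0 < lam) (h1 : lam < 1) {θ C : ℝ} (hθ : 0 < θ) (hC0 : 0 ≤ C)
    (hC : ∀ z z', |c z - c z'| ≤ C * extDist lam z z' ^ θ) {a b : sft M} {n : ℕ} {r : ℝ}
    (h : Reach c a b n r) {b' : sft M} (hb : b'.1 0 = b.1 0) :
    ∃ (a' : sft M) (r' : ℝ), Reach c a' b' n r' ∧ (∀ j < n, a'.1 j = a.1 j) ∧
      sftDist lam a a' ≤ sftDist lam b b' ∧
      |r - r'| ≤ C / (1 - lam ^ θ) * sftDist lam b b' ^ θ := by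
  have hl1 : lam ^ θ < 1 := Real.rpow_lt_one h0.le h1 hθ
  induction h generalizing b' with
  | nil =>
    refine ⟨b', 0, Reach.nil, by simp, le_rfl, ?_⟩
    have := Real.rpow_nonneg (sftDist_nonneg h0 a b') θ
    have : 0 < 1 - lam ^ θ := by linarith
    simp only [sub_self, abs_zero]
    positivity
  | @cons n r z hr ih =>
    -- The past of z is kept and only the future is replaced, which is admissible because the first
    -- letters agree.
    let z' : natExt M := ⟨(z.1.1, b'.1), z.2.1, b'.2, by
      have := z.2.2.2
      change M (z.1.1 0) (b'.1 0) = 1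
      rw [hb]
      exact this⟩
    have hzz : sftDist lam (tau z) (tau z') ≤ lam * sftDist lam (proj z) b' :=
      sftDist_tau_le (z := z) (z' := z') h0 h1 rfl
    have hd := sftDist_nonneg h0 (proj z) b'
    obtain ⟨a', r', ha', hpre, hda, hrr⟩ := ih (b' := tau z') rfl
    refine ⟨a', r' + c z', Reach.cons z' ha', fun j hj => ?_, ?_, ?_⟩
    · rcases (Nat.lt_succ_iff.1 hj).lt_or_eq with h | h
      · exact hpre j h
      · have e1 := hr.apply_eq 0
        have e2 := ha'.apply_eq 0
        rw [h]
        exact e2.symm.trans e1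
    · refine hda.trans (hzz.trans ?_)
      exact mul_le_of_le_one_left hd h1.le
    · have hcz := hC z z'
      have hext : extDist lam z z' = sftDist lam (proj z) b' := by
        simp only [extDist, z', seqDist_self]
        exact max_eq_right (seqDist_nonneg h0 _ _)
      rw [hext] at hcz
      have hpow : sftDist lam (tau z) (tau z') ^ θ ≤ lam ^ θ * sftDist lam (proj z) b' ^ θ := by
        rw [← Real.mul_rpow h0.le hd]
        exact Real.rpow_le_rpow (sftDist_nonneg h0 _ _) hzz hθ.le
      have hpos : 0 < 1 - lam ^ θ := by linarith
      have hD : 0 ≤ C / (1 - lam ^ θ) := by positivity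
      have h3 := hrr.trans (mul_le_mul_of_nonneg_left hpow hD)
      -- The constant D = C / (1 - lam ^ θ) sums the geometric series of errors, that is, D = D *
      -- lam ^ θ + C.
      have h4 : C / (1 - lam ^ θ) * sftDist lam (proj z) b' ^ θ =
          C / (1 - lam ^ θ) * (lam ^ θ * sftDist lam (proj z) b' ^ θ) +
            C * sftDist lam (proj z) b' ^ θ := by
        field_simp
        ring
      rw [h4]
      have h5 : r + c z - (r' + c z') = (r - r') + (c z - c z') := by ring
      rw [h5]
      exact (abs_add_le _ _).trans (add_le_add h3 hcz)

/-- Nonnegativity of the cost of loops bounds from below the cost of all paths. -/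
theorem exists_forall_neg_le_reach (hM01 : ∀ i j, M i j = 0 ∨ M i j = 1)
    (hMirr : M.IsIrreducible) (h0 : 0 < lam) (h1 : lam < 1) {θ : ℝ} (hθ : 0 < θ)
    (hc : IsHolder (extDist lam) θ c)
    (hloop : ∀ (x : sft M) (n : ℕ) (r : ℝ), 1 ≤ n → Reach c x x n r → 0 ≤ r) :
    ∃ K : ℝ, ∀ (a b : sft M) (n : ℕ) (r : ℝ), Reach c a b n r → -K ≤ r := by
  obtain ⟨P, hP⟩ := exists_periodic hM01 hMirr
  obtain ⟨B, hB⟩ := (isCompact_univ (X := natExt M)).exists_bound_of_continuousOn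
    (hc.continuous_natExt h0 h1 hθ).continuousOn
  obtain ⟨C, hC⟩ := hc
  have hC' (z z' : natExt M) : |c z - c z'| ≤ |C| * extDist lam z z' ^ θ :=
    (hC z z').trans (mul_le_mul_of_nonneg_right (le_abs_self C)
      (Real.rpow_nonneg (extDist_nonneg h0 _ _) _))
  have hl1 : lam ^ θ < 1 := Real.rpow_lt_one h0.le h1 hθ
  have hpos : 0 < 1 - lam ^ θ := by linarith
  refine ⟨|C| / (1 - lam ^ θ) + P * |B|, fun a b n r hr => ?_⟩
  obtain ⟨p, hp1, hpP, x, hx, hper⟩ := hP a n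
  have hb : (shift^[n] x).1 0 = b.1 0 := by
    rw [shift_iterate_apply, hr.apply_eq 0, zero_add, add_zero, hx n le_rfl]
  obtain ⟨a', r', hr', hpre, -, hrr⟩ := hr.shadow h0 h1 hθ (abs_nonneg C) hC' hb
  -- The shadowing path ends at the n-th shift of x and starts with the first n letters of a, which
  -- are those of x; so it starts at x itself.
  have ha' : a' = x := by
    apply Subtype.ext
    funext j
    rcases lt_or_ge j n with h | h
    · rw [hpre j h, hx j h.le]
    · obtain ⟨i, rfl⟩ := Nat.exists_eq_add_of_le h
      rw [← hr'.apply_eq i, shift_iterate_apply, add_comm]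
  rw [ha'] at hr'
  -- The remaining p ≤ P shifts return to x at cost at most p * |B|, which completes a loop.
  obtain ⟨t, ht, htB⟩ := exists_reach_shift (c := c) (exists_tau_eq hM01 hMirr) (B := |B|)
    (fun z => (le_abs_self _).trans ((hB z (Set.mem_univ z)).trans (le_abs_self B)))
    (shift^[n] x) p
  have hxx : shift^[p] (shift^[n] x) = x := by
    apply Subtype.ext
    funext j
    rw [shift_iterate_apply, shift_iterate_apply, add_assoc, add_comm p n, hper]
  rw [hxx] at ht
  have h2 := hloop x (n + p) (r' + t) (by omega) (hr'.trans ht)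
  have h3 : sftDist lam b (shift^[n] x) ^ θ ≤ 1 :=
    Real.rpow_le_one (sftDist_nonneg h0 _ _) (sftDist_le_one h0 h1 _ _) hθ.le
  have h4 : |C| / (1 - lam ^ θ) * sftDist lam b (shift^[n] x) ^ θ ≤ |C| / (1 - lam ^ θ) :=
    mul_le_of_le_one_right (by positivity) h3
  have h5 : (p : ℝ) * |B| ≤ P * |B| := by
    gcongr
  linarith [(abs_le.1 (hrr.trans h4)).1]

end Reach

/-! ### Holonomic measures carried by loops. -/

section Holonomic

variable {s : ℕ} {M : Matrix (Fin s) (Fin s) ℤ}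

/-- The uniform measure on the points of a path. -/
def orbitMeasure (z : ℕ → natExt M) (n : ℕ) : Measure (natExt M) :=
  (n : ENNReal)⁻¹ • ∑ i ∈ Finset.range n, Measure.dirac (z (i + 1))

theorem integral_orbitMeasure (z : ℕ → natExt M) (n : ℕ) (f : natExt M → ℝ) :
    ∫ w, f w ∂(orbitMeasure z n) = (n : ℝ)⁻¹ * ∑ i ∈ Finset.range n, f (z (i + 1)) := by
  rw [orbitMeasure, integral_smul_measure, integral_finsetSum_measure]
  · simp
  · intro i _
    exact integrable_dirac (by simp)

theorem isHolonomic_orbitMeasure {z : ℕ → natExt M} {n : ℕ} (hn : 1 ≤ n)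
    (hz : ∀ i < n, proj (z i) = tau (z (i + 1))) (hloop : proj (z n) = proj (z 0)) :
    IsHolonomic (orbitMeasure z n) := by
  refine ⟨⟨?_⟩, fun f => ?_⟩
  · have : (n : ENNReal) ≠ 0 := by
      simp
      omega
    simp [orbitMeasure, ENNReal.inv_mul_cancel this (ENNReal.natCast_ne_top n)]
  · rw [integral_orbitMeasure z n fun w => f (tau w), integral_orbitMeasure z n fun w => f (proj w)]
    congr 1
    -- The two sums of f ∘ `proj` are now over 0, …, n - 1 and 1, …, n; they agree because the loop
    -- closes.
    rw [Finset.sum_congr rfl fun i hi => by rw [← hz i (Finset.mem_range.1 hi)]]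
    have h1 := Finset.sum_range_succ (fun i => f (proj (z i))) n
    have h2 := Finset.sum_range_succ' (fun i => f (proj (z i))) n
    rw [h1, hloop] at h2
    exact add_right_cancel h2

theorem reach_loop_nonneg (hs : Function.Surjective (proj : natExt M → sft M))
    {A : natExt M → ℝ} {B : ℝ} (hB : ∀ z, |A z| ≤ B) {x : sft M} {n : ℕ} {r : ℝ} (hn : 1 ≤ n)
    (h : Reach (fun z => A z - minValue A) x x n r) : 0 ≤ r := by
  obtain ⟨z, h0, hl, hz, hr⟩ := h.exists_seq hs
  have hμ := isHolonomic_orbitMeasure hn hz (hl.trans h0.symm)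
  have hle : minValue A ≤ ∫ w, A w ∂(orbitMeasure z n) := by
    -- Boundedness of A keeps the real `sInf` from taking its default value; attainment of the
    -- minimum plays no role.
    refine csInf_le ⟨-B, ?_⟩ ⟨_, hμ, rfl⟩
    rintro _ ⟨μ, ⟨hp, -⟩, rfl⟩
    have := norm_integral_le_of_norm_le_const (μ := μ) (f := A) (C := B)
      (Eventually.of_forall hB)
    simp only [probReal_univ, mul_one, Real.norm_eq_abs] at this
    exact (abs_le.1 this).1
  rw [integral_orbitMeasure] at hle
  have hn' : (0 : ℝ) < n := by exact_mod_cast hn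
  rw [hr, Finset.sum_sub_distrib]
  simp only [Finset.sum_const, Finset.card_range, nsmul_eq_mul]
  rw [inv_mul_eq_div, le_div_iff₀ hn'] at hle
  linarith

end Holonomic

/-! ### Largest sub-actions below a function, and removal of contacts over a cylinder. -/

section Envelope

variable {s : ℕ} {M : Matrix (Fin s) (Fin s) ℤ} {lam θ : ℝ} {c : natExt M → ℝ}

/-- The largest sub-action below a Hölder function. -/
theorem exists_envelope (h0 : 0 < lam) (h1 : lam < 1) (hθ : 0 < θ)
    (hc : IsHolder (extDist lam) θ c) {K : ℝ}
    (hK : ∀ (a b : sft M) (n : ℕ) (r : ℝ), Reach c a b n r → -K ≤ r)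
    {f : C(sft M, ℝ)} (hf : IsHolder (sftDist lam) θ f) :
    ∃ u : C(sft M, ℝ), IsHolder (sftDist lam) θ u ∧ (∀ z, u (proj z) - u (tau z) ≤ c z) ∧
      (∀ a b n r, Reach c a b n r → u b ≤ f a + r) ∧
      ∀ b t, (∀ a n r, Reach c a b n r → t ≤ f a + r) → t ≤ u b := by
  set S : sft M → Set ℝ := fun b => {t | ∃ a n r, Reach c a b n r ∧ t = f a + r} with hS
  have hne (b : sft M) : (S b).Nonempty := ⟨_, b, 0, 0, Reach.nil, rfl⟩
  have hfb (a : sft M) : |f a| ≤ ‖f‖ := f.norm_coe_le_norm a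
  have hlb (b : sft M) : ∀ t ∈ S b, -(‖f‖ + K) ≤ t := by
    rintro _ ⟨a, n, r, hr, rfl⟩
    linarith [hK a b n r hr, (abs_le.1 (hfb a)).1]
  have hle (a b : sft M) (n : ℕ) (r : ℝ) (h : Reach c a b n r) : sInf (S b) ≤ f a + r :=
    csInf_le ⟨_, hlb b⟩ ⟨a, n, r, h, rfl⟩
  have hge (b : sft M) (t : ℝ) (h : ∀ a n r, Reach c a b n r → t ≤ f a + r) :
      t ≤ sInf (S b) := by
    refine le_csInf (hne b) ?_
    rintro _ ⟨a, n, r, hr, rfl⟩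
    exact h a n r hr
  have hl1 : lam ^ θ < 1 := Real.rpow_lt_one h0.le h1 hθ
  have hpos : 0 < 1 - lam ^ θ := by linarith
  have hholder : IsHolder (sftDist lam) θ fun b => sInf (S b) := by
    obtain ⟨F, hF⟩ := hf
    obtain ⟨C, hC⟩ := hc
    have hC' (z z' : natExt M) : |c z - c z'| ≤ |C| * extDist lam z z' ^ θ :=
      (hC z z').trans (mul_le_mul_of_nonneg_right (le_abs_self C)
        (Real.rpow_nonneg (extDist_nonneg h0 _ _) _))
    have hD : 0 ≤ |C| / (1 - lam ^ θ) := by positivity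
    have honeside (b b' : sft M) (hb : b'.1 0 = b.1 0) :
        sInf (S b') - sInf (S b) ≤ (|F| + |C| / (1 - lam ^ θ)) * sftDist lam b b' ^ θ := by
      rw [sub_le_comm]
      refine hge b _ fun a n r hr => ?_
      obtain ⟨a', r', hr', -, hda, hrr⟩ := hr.shadow h0 h1 hθ (abs_nonneg C) hC' hb
      have h2 := hle a' b' n r' hr'
      have h3 : sftDist lam a a' ^ θ ≤ sftDist lam b b' ^ θ :=
        Real.rpow_le_rpow (sftDist_nonneg h0 _ _) hda hθ.le
      have h4 : |f a - f a'| ≤ |F| * sftDist lam b b' ^ θ := by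
        refine (hF a a').trans (mul_le_mul (le_abs_self F) h3 ?_ (abs_nonneg F))
        exact Real.rpow_nonneg (sftDist_nonneg h0 _ _) _
      rw [add_mul]
      linarith [(abs_le.1 h4).1, (abs_le.1 hrr).1]
    -- The first two terms come from shadowing when the first letters agree. Otherwise the distance
    -- is 1, and the last term bounds the oscillation of the infimum, whose values lie between -(‖f‖
    -- + K) and ‖f‖.
    refine ⟨|F| + |C| / (1 - lam ^ θ) + (2 * ‖f‖ + |K|), fun b b' => ?_⟩
    by_cases hb : b'.1 0 = b.1 0
    · have h2 := honeside b b' hb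
      have h3 := honeside b' b hb.symm
      rw [sftDist_comm b' b] at h3
      have h4 : |sInf (S b) - sInf (S b')| ≤
          (|F| + |C| / (1 - lam ^ θ)) * sftDist lam b b' ^ θ :=
        abs_le.2 ⟨by linarith, by linarith⟩
      refine h4.trans (mul_le_mul_of_nonneg_right ?_ (Real.rpow_nonneg (sftDist_nonneg h0 _ _) _))
      linarith [norm_nonneg f, abs_nonneg K]
    · have h2 : sftDist lam b b' = 1 := seqDist_eq_one (Ne.symm hb)
      rw [h2, Real.one_rpow, mul_one]
      have hup (x : sft M) : sInf (S x) ≤ ‖f‖ := by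
        linarith [hle x x 0 0 Reach.nil, (abs_le.1 (hfb x)).2]
      have hlow (x : sft M) : -(‖f‖ + K) ≤ sInf (S x) := le_csInf (hne x) (hlb x)
      have h3 := abs_nonneg F
      rw [abs_le]
      constructor <;> linarith [hup b, hup b', hlow b, hlow b', le_abs_self K]
  refine ⟨⟨_, hholder.continuous_sft h0 h1 hθ⟩, hholder, fun z => ?_, hle, hge⟩
  change sInf (S (proj z)) - sInf (S (tau z)) ≤ c z
  rw [sub_le_comm]
  refine hge _ _ fun a n r hr => ?_
  linarith [hle a (proj z) (n + 1) (r + c z) (Reach.cons z hr)]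

/-- The cylinder of a finite word. -/
def wordCylinder (M : Matrix (Fin s) (Fin s) ℤ) (p : Σ m : ℕ, Fin m → Fin s) : Set (sft M) :=
  {x | ∀ j : Fin p.1, x.1 j = p.2 j}

theorem isClosed_wordCylinder (p : Σ m : ℕ, Fin m → Fin s) : IsClosed (wordCylinder M p) := by
  have h : wordCylinder M p = ⋂ j : Fin p.1, {x | x.1 j = p.2 j} := by
    ext x
    simp [wordCylinder]
  rw [h]
  exact isClosed_iInter fun j => isClosed_eq
    ((continuous_apply _).comp continuous_subtype_val) continuous_const

theorem sftDist_le_of_mem_wordCylinder (h0 : 0 < lam) (h1 : lam < 1)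
    {p : Σ m : ℕ, Fin m → Fin s} {x x' : sft M} (hx : x ∈ wordCylinder M p)
    (hx' : x' ∈ wordCylinder M p) : sftDist lam x x' ≤ lam ^ p.1 :=
  seqDist_le_pow h0 h1 fun j hj => (hx ⟨j, hj⟩).trans (hx' ⟨j, hj⟩).symm

theorem pow_le_sftDist_of_wordCylinder (h0 : 0 < lam) (h1 : lam < 1)
    {p : Σ m : ℕ, Fin m → Fin s} {x x' : sft M} (hx : x ∈ wordCylinder M p)
    (hx' : x' ∉ wordCylinder M p) : lam ^ p.1 ≤ sftDist lam x x' := by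
  refine seqDist_ge_pow h0 h1 ?_
  by_contra! h
  exact hx' fun j => (h j j.2).symm.trans (hx j)

theorem isHolder_indicator_wordCylinder (h0 : 0 < lam) (h1 : lam < 1) (hθ : 0 < θ)
    (p : Σ m : ℕ, Fin m → Fin s) (h : ℝ) :
    IsHolder (sftDist lam) θ ((wordCylinder M p).indicator fun _ => h) := by
  have hp : 0 < (lam ^ p.1) ^ θ := by positivity
  have key {x x' : sft M} (hx : x ∈ wordCylinder M p) (hx' : x' ∉ wordCylinder M p) :
      |h| ≤ |h| / (lam ^ p.1) ^ θ * sftDist lam x x' ^ θ := by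
    have : (lam ^ p.1) ^ θ ≤ sftDist lam x x' ^ θ :=
      Real.rpow_le_rpow (by positivity) (pow_le_sftDist_of_wordCylinder h0 h1 hx hx') hθ.le
    rw [div_mul_eq_mul_div, le_div_iff₀ hp]
    gcongr
  refine ⟨|h| / (lam ^ p.1) ^ θ, fun x x' => ?_⟩
  have hnn : 0 ≤ |h| / (lam ^ p.1) ^ θ * sftDist lam x x' ^ θ :=
    mul_nonneg (by positivity) (Real.rpow_nonneg (sftDist_nonneg h0 _ _) _)
  by_cases hx : x ∈ wordCylinder M p <;> by_cases hx' : x' ∈ wordCylinder M p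
  · simpa [hx, hx'] using hnn
  · simpa [hx, hx'] using key hx hx'
  · rw [sftDist_comm]
    simpa [hx, hx'] using key hx' hx
  · simpa [hx, hx'] using hnn

/-- Paths returning to the set `W` have a cost uniformly above the variation of `v`. -/
def ReturnsCostly (c : natExt M → ℝ) (v : sft M → ℝ) (W : Set (sft M)) : Prop :=
  ∃ h : ℝ, 0 < h ∧ ∀ a ∈ W, ∀ b ∈ W, ∀ (n : ℕ) (r : ℝ), 1 ≤ n → Reach c a b n r →
    v b + h ≤ v a + r

/-- Lowering a sub-action on a set with costly returns removes the contact points over it. -/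
theorem exists_strict_of_returnsCostly (h0 : 0 < lam) (h1 : lam < 1) (hθ : 0 < θ)
    (hc : IsHolder (extDist lam) θ c) {K : ℝ}
    (hK : ∀ (a b : sft M) (n : ℕ) (r : ℝ), Reach c a b n r → -K ≤ r)
    {v : C(sft M, ℝ)} (hv : IsHolder (sftDist lam) θ v)
    (hsub : ∀ z, v (proj z) - v (tau z) ≤ c z) {p : Σ m : ℕ, Fin m → Fin s}
    (hp : ReturnsCostly c v (wordCylinder M p)) :
    ∃ u : C(sft M, ℝ), IsHolder (sftDist lam) θ u ∧ (∀ z, u (proj z) - u (tau z) ≤ c z) ∧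
      ∀ z, proj z ∈ wordCylinder M p → u (proj z) - u (tau z) < c z := by
  obtain ⟨h, hh, hret⟩ := hp
  have hf := hv.sub (isHolder_indicator_wordCylinder (M := M) h0 h1 hθ p h)
  obtain ⟨u, hu, hus, hle, hge⟩ := exists_envelope h0 h1 hθ hc hK
    (f := ⟨_, hf.continuous_sft h0 h1 hθ⟩) hf
  refine ⟨u, hu, hus, fun z hz => ?_⟩
  have h2 := hle _ _ 0 0 (Reach.nil (a := proj z))
  simp only [ContinuousMap.coe_mk, Set.indicator_of_mem hz] at h2
  -- Extending a path to `tau z` by the arrow z makes it end in the cylinder. If it also starts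
  -- there, it is a return, whose excess cost h offsets the lowering; if not, v was not lowered at
  -- its start.
  have h3 : v (proj z) - c z ≤ u (tau z) := by
    refine hge _ _ fun a n r hr => ?_
    have hr' := Reach.cons z hr
    simp only [ContinuousMap.coe_mk]
    by_cases ha : a ∈ wordCylinder M p
    · rw [Set.indicator_of_mem ha]
      linarith [hret a ha _ hz _ _ (Nat.le_add_left 1 n) hr']
    · rw [Set.indicator_of_notMem ha]
      linarith [hr'.le_add hsub]
  linarith

end Envelope

/-! ### The non-wandering set against contact loci. -/

section NonWandering

variable {s : ℕ} {M : Matrix (Fin s) (Fin s) ℤ} {lam θ : ℝ} {A : natExt M → ℝ}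

theorem exists_returnsCostly (hs : Function.Surjective (proj : natExt M → sft M))
    (h0 : 0 < lam) (h1 : lam < 1) (hθ : 0 < θ) {v : C(sft M, ℝ)}
    (hv : IsHolder (sftDist lam) θ v) (hsub : IsSubaction A v) {x : sft M}
    (hx : x ∉ nonWandering lam A) :
    ∃ p, x ∈ wordCylinder M p ∧
      ReturnsCostly (fun z => A z - minValue A) v (wordCylinder M p) := by
  simp only [nonWandering, Set.mem_ofPred_eq, not_forall, not_exists, not_and, not_lt] at hx
  obtain ⟨ε, hε, hx⟩ := hx
  obtain ⟨C, hC⟩ := hv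
  obtain ⟨m, hm1, hm2⟩ := ((eventually_pow_rpow_lt h0 h1 hθ |C| (half_pos hε)).and
    ((tendsto_pow_atTop_nhds_zero_of_lt_one h0.le h1).eventually_lt_const hε)).exists
  have hxp : x ∈ wordCylinder M ⟨m, fun j => x.1 j⟩ := fun j => rfl
  refine ⟨⟨m, fun j => x.1 j⟩, hxp, ε / 2, half_pos hε, fun a ha b hb n r hn hr => ?_⟩
  have hosc : |v b - v a| < ε / 2 := by
    refine lt_of_le_of_lt ((hC b a).trans ?_) hm1
    exact mul_le_mul (le_abs_self C) (Real.rpow_le_rpow (sftDist_nonneg h0 _ _)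
      (sftDist_le_of_mem_wordCylinder h0 h1 hb ha) hθ.le)
      (Real.rpow_nonneg (sftDist_nonneg h0 _ _) _) (abs_nonneg C)
  have hle := hr.le_add hsub
  obtain ⟨z, hz0, hzn, hz, hrz⟩ := hr.exists_seq hs
  have hcost := hx n hn (fun i => z i) (fun i => hz i i.2)
    (by
      simp only [Fin.val_zero, hz0]
      exact (sftDist_le_of_mem_wordCylinder h0 h1 ha hxp).trans_lt hm2)
    (by
      simp only [Fin.val_last, hzn]
      exact (sftDist_le_of_mem_wordCylinder h0 h1 hb hxp).trans_lt hm2)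
  simp only [Fin.val_succ] at hcost
  rw [Fin.sum_univ_eq_sum_range (fun i => A (z (i + 1)) - minValue A), ← hrz] at hcost
  obtain ⟨hlo, hhi⟩ := abs_lt.1 hosc
  -- A cost at most -ε would contradict the sub-action inequality, as v varies by less than ε / 2 on
  -- the cylinder. So the cost is at least ε, leaving a margin of ε / 2.
  rcases le_abs.1 hcost with h | h <;> linarith

theorem tendsto_of_sftDist_lt (h0 : 0 < lam) (h1 : lam < 1) {x : sft M} {b : ℕ → sft M}
    (hb : ∀ m, sftDist lam (b m) x < lam ^ m) : Tendsto b atTop (𝓝 x) := by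
  refine tendsto_subtype_rng.2 (tendsto_pi_nhds.2 fun j => ?_)
  refine tendsto_const_nhds.congr' ?_
  filter_upwards [eventually_gt_atTop j] with m hm
  exact (eq_of_seqDist_lt_pow h0 h1 (hb m) hm).symm

/-- The sub-action inequality telescopes along all arrows but the last. For almost closed paths of
almost zero cost this forces the last arrow to be nearly a contact; a limit of such arrows is a
contact over x. -/
theorem nonWandering_subset_proj_contactLocus (h0 : 0 < lam) (h1 : lam < 1)
    (hA : Continuous A) {u : C(sft M, ℝ)} (hu : IsSubaction A u) :
    nonWandering lam A ⊆ proj '' contactLocus A u := by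
  intro x hx
  have hex (m : ℕ) : ∃ (a : sft M) (z : natExt M), sftDist lam a x < lam ^ m ∧
      sftDist lam (proj z) x < lam ^ m ∧
      A z - minValue A + u (tau z) ≤ u a + lam ^ m := by
    obtain ⟨k, hk, z, hz, hd0, hdk, hsum⟩ := hx (lam ^ m) (by positivity)
    have hr : Reach (fun z => A z - minValue A) _ _ k _ := hz.reach
    obtain ⟨w, n, t, hw, ht, htr⟩ := hr.exists_last hk
    refine ⟨_, w, hd0, by rwa [hw], ?_⟩
    have := ht.le_add hu
    linarith [(abs_lt.1 hsum).2]
  choose a z ha hz hle using hex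
  obtain ⟨w, φ, hφ, hw⟩ := CompactSpace.tendsto_subseq z
  have hpw : proj w = x :=
    tendsto_nhds_unique ((continuous_proj.tendsto w).comp hw)
      ((tendsto_of_sftDist_lt h0 h1 hz).comp hφ.tendsto_atTop)
  refine ⟨w, ?_, hpw⟩
  have hlim : A w - minValue A + u (tau w) ≤ u x + 0 := by
    have hl : Tendsto (fun m => A (z (φ m)) - minValue A + u (tau (z (φ m)))) atTop
        (𝓝 (A w - minValue A + u (tau w))) :=
      (((hA.sub continuous_const).add (u.continuous.comp continuous_tau)).tendsto w).comp hw
    have hr : Tendsto (fun m => u (a (φ m)) + lam ^ φ m) atTop (𝓝 (u x + 0)) :=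
      (((u.continuous.tendsto x).comp (tendsto_of_sftDist_lt h0 h1 ha)).add
        (tendsto_pow_atTop_nhds_zero_of_lt_one h0.le h1)).comp hφ.tendsto_atTop
    exact le_of_tendsto_of_tendsto' hl hr fun m => hle (φ m)
  have := hu w
  rw [← hpw] at hlim
  change u (proj w) - u (tau w) = A w - minValue A
  linarith

end NonWandering

/-! ### Topology and convexity of the space of Hölder sub-actions. -/

section HolderSubaction

variable {s : ℕ} {M : Matrix (Fin s) (Fin s) ℤ} {lam : Set.Ioo (0 : ℝ) 1} {θ : ℝ}
  {A : natExt M → ℝ}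

theorem IsHolder.abs_sub_le_holderSeminorm (hθ : 0 < θ) {f : C(sft M, ℝ)}
    (hf : IsHolder (sftDist lam.1) θ f) (x x' : sft M) :
    |f x - f x'| ≤ holderSeminorm lam.1 θ f * sftDist lam.1 x x' ^ θ := by
  by_cases hx : x.1 = x'.1
  · have : x = x' := Subtype.ext hx
    subst this
    simp [sftDist, seqDist_self, Real.zero_rpow hθ.ne']
  · have hd : 0 < sftDist lam.1 x x' := by
      have := lam.2.1
      simp only [sftDist, seqDist, hx, if_false]
      positivity
    exact (div_le_iff₀ (Real.rpow_pos_of_pos hd θ)).1 (abs_div_le_holderSeminorm hf (x, x'))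

theorem HolderSubaction.dist_eq (u v : HolderSubaction lam θ A) :
    dist u v = ‖u.fn - v.fn‖ + holderSeminorm lam.1 θ (u.fn - v.fn) := rfl

theorem HolderSubaction.isHolder_sub (u v : HolderSubaction lam θ A) :
    IsHolder (sftDist lam.1) θ (u.fn - v.fn) :=
  u.isHolder.sub v.isHolder

theorem HolderSubaction.norm_sub_le_dist (u v : HolderSubaction lam θ A) :
    ‖u.fn - v.fn‖ ≤ dist u v := by
  rw [dist_eq]
  exact le_add_of_nonneg_right (holderSeminorm_nonneg (isHolder_sub u v))

theorem HolderSubaction.abs_sub_le_dist (u v : HolderSubaction lam θ A) (x : sft M) :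
    |u.fn x - v.fn x| ≤ dist u v :=
  ((u.fn - v.fn).norm_coe_le_norm x).trans (norm_sub_le_dist u v)

theorem HolderSubaction.abs_sub_sub_le_dist (hθ : 0 < θ) (u v : HolderSubaction lam θ A)
    (x x' : sft M) :
    |(u.fn x - v.fn x) - (u.fn x' - v.fn x')| ≤ dist u v * sftDist lam.1 x x' ^ θ := by
  refine ((isHolder_sub u v).abs_sub_le_holderSeminorm hθ x x').trans ?_
  refine mul_le_mul_of_nonneg_right ?_ (Real.rpow_nonneg (sftDist_nonneg lam.2.1 _ _) _)
  rw [dist_eq]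
  exact le_add_of_nonneg_left (norm_nonneg _)

theorem holderSeminorm_smul {t : ℝ} (ht : 0 ≤ t) (f : C(sft M, ℝ)) :
    holderSeminorm lam.1 θ (t • f) = t * holderSeminorm lam.1 θ f := by
  unfold holderSeminorm
  rw [Real.mul_iSup_of_nonneg ht]
  congr 1
  ext p
  simp only [ContinuousMap.smul_apply, smul_eq_mul]
  rw [← mul_sub, abs_mul, abs_of_nonneg ht, mul_div_assoc]

/-- The segment between two Hölder sub-actions. -/
def HolderSubaction.segment (v w : HolderSubaction lam θ A) (t : ℝ) (ht0 : 0 ≤ t)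
    (ht1 : t ≤ 1) : HolderSubaction lam θ A where
  fn := v.fn - t • (v.fn - w.fn)
  isHolder := by
    refine v.isHolder.sub ?_
    obtain ⟨C, hC⟩ := isHolder_sub v w
    refine ⟨t * C, fun x x' => ?_⟩
    have := mul_le_mul_of_nonneg_left (hC x x') ht0
    simp only [ContinuousMap.smul_apply, smul_eq_mul]
    rw [← mul_sub, abs_mul, abs_of_nonneg ht0, mul_assoc]
    exact this
  isSubaction z := by
    have h1 := mul_le_mul_of_nonneg_left (v.isSubaction z) (sub_nonneg.2 ht1)
    have h2 := mul_le_mul_of_nonneg_left (w.isSubaction z) ht0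
    simp only [ContinuousMap.sub_apply, ContinuousMap.smul_apply, smul_eq_mul]
    linarith

theorem HolderSubaction.dist_segment (v w : HolderSubaction lam θ A) {t : ℝ} (ht0 : 0 ≤ t)
    (ht1 : t ≤ 1) : dist v (segment v w t ht0 ht1) = t * dist v w := by
  have : v.fn - (segment v w t ht0 ht1).fn = t • (v.fn - w.fn) := sub_sub_cancel _ _
  rw [dist_eq, this, norm_smul, holderSeminorm_smul ht0, dist_eq, Real.norm_of_nonneg ht0]
  ring

/-- The Hölder sub-actions without contact points over the set `W`. -/
def strictOver (lam : Set.Ioo (0 : ℝ) 1) (θ : ℝ) (A : natExt M → ℝ) (W : Set (sft M)) :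
    Set (HolderSubaction lam θ A) :=
  {u | ∀ z, proj z ∈ W → u.fn (proj z) - u.fn (tau z) < A z - minValue A}

theorem isOpen_strictOver (hA : Continuous A) {W : Set (sft M)} (hW : IsClosed W) :
    IsOpen (strictOver lam θ A W) := by
  refine Metric.isOpen_iff.2 fun u hu => ?_
  have hcont : Continuous fun z => A z - minValue A - (u.fn (proj z) - u.fn (tau z)) :=
    (hA.sub continuous_const).sub ((u.fn.continuous.comp continuous_proj).sub
      (u.fn.continuous.comp continuous_tau))
  obtain ⟨δ, hδ, hle⟩ := (hW.preimage continuous_proj).isCompact.exists_forall_le'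
    hcont.continuousOn (a := 0) fun z hz => sub_pos.2 (hu z hz)
  -- The values at `proj z` and at `tau z` each move by less than δ / 2.
  refine ⟨δ / 2, half_pos hδ, fun v hv z hz => ?_⟩
  rw [Metric.mem_ball] at hv
  have h1 := hle z hz
  have h2 := (abs_le.1 (v.abs_sub_le_dist u (proj z))).2
  have h3 := (abs_le.1 (v.abs_sub_le_dist u (tau z))).1
  linarith

theorem dense_strictOver {W : Set (sft M)} (hW : (strictOver lam θ A W).Nonempty) :
    Dense (strictOver lam θ A W) := by
  obtain ⟨w, hw⟩ := hW
  refine Metric.dense_iff.2 fun v ε hε => ?_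
  have hD : 0 ≤ dist v w := dist_nonneg
  have hpos : 0 < dist v w + ε := by linarith
  -- This weight is positive, which gives strictness, and moves v by less than ε, even when v = w.
  have ht0 : 0 < ε / (dist v w + ε) := by positivity
  have ht1 : ε / (dist v w + ε) ≤ 1 := (div_le_one hpos).2 (by linarith)
  refine ⟨HolderSubaction.segment v w _ ht0.le ht1, ?_, fun z hz => ?_⟩
  · rw [Metric.mem_ball, dist_comm, HolderSubaction.dist_segment, div_mul_eq_mul_div,
      div_lt_iff₀ hpos]
    nlinarith
  · have h1 := mul_le_mul_of_nonneg_left (v.isSubaction z) (sub_nonneg.2 ht1)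
    have h2 := mul_lt_mul_of_pos_left (hw z hz) ht0
    simp only [HolderSubaction.segment, ContinuousMap.sub_apply, ContinuousMap.smul_apply,
      smul_eq_mul]
    linarith

/-- Countably many Hölder sub-actions have a common Hölder sub-action whose contact locus is
contained in all of theirs. -/
theorem exists_forall_mem_strictOver (hθ : 0 < θ) {ι : Type*} [Countable ι]
    (v : HolderSubaction lam θ A) (u : ι → HolderSubaction lam θ A) :
    ∃ w : HolderSubaction lam θ A, ∀ i W, u i ∈ strictOver lam θ A W →
      w ∈ strictOver lam θ A W := by
  have := Encodable.ofCountable ι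
  obtain ⟨e, he, S, hS, hS1⟩ := posSumOfEncodable one_pos ι
  -- The candidate is v + ∑ t i (u i - v). Dividing by 1 + dist makes the series converge with a
  -- Hölder bound, while t i ≤ e i keeps the total weight at most 1.
  set t : ι → ℝ := fun i => e i / (1 + dist (u i) v) with ht
  have hD (i : ι) : 0 < 1 + dist (u i) v := by positivity
  have ht0 (i : ι) : 0 < t i := div_pos (he i) (hD i)
  have hte (i : ι) : t i ≤ e i := div_le_self (he i).le
    (by linarith [dist_nonneg (x := u i) (y := v)])
  have htD (i : ι) : t i * dist (u i) v ≤ e i := by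
    rw [ht, div_mul_eq_mul_div, div_le_iff₀ (hD i)]
    nlinarith [he i]
  have hsum (x : sft M) : Summable fun i => t i * ((u i).fn x - v.fn x) := by
    refine Summable.of_norm_bounded hS.summable fun i => ?_
    rw [Real.norm_eq_abs, abs_mul, abs_of_pos (ht0 i)]
    exact (mul_le_mul_of_nonneg_left ((u i).abs_sub_le_dist v x) (ht0 i).le).trans (htD i)
  have hholder : IsHolder (sftDist lam.1) θ fun x => ∑' i, t i * ((u i).fn x - v.fn x) := by
    refine ⟨S, fun x x' => ?_⟩
    rw [← (hsum x).tsum_sub (hsum x'), ← Real.norm_eq_abs]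
    refine tsum_of_norm_bounded (hS.mul_right _) fun i => ?_
    rw [← mul_sub, Real.norm_eq_abs, abs_mul, abs_of_pos (ht0 i)]
    refine (mul_le_mul_of_nonneg_left ((u i).abs_sub_sub_le_dist hθ v x x') (ht0 i).le).trans ?_
    rw [← mul_assoc]
    exact mul_le_mul_of_nonneg_right (htD i) (Real.rpow_nonneg (sftDist_nonneg lam.2.1 _ _) _)
  let g : C(sft M, ℝ) := ⟨_, hholder.continuous_sft lam.2.1 lam.2.2 hθ⟩
  have hg (z : natExt M) : HasSum (fun i => t i * (((u i).fn (proj z) - (u i).fn (tau z)) -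
      (v.fn (proj z) - v.fn (tau z)))) (g (proj z) - g (tau z)) := by
    have h := (hsum (proj z)).hasSum.sub (hsum (tau z)).hasSum
    simp only [← mul_sub, sub_sub_sub_comm _ (v.fn (proj z))] at h
    exact h
  -- Summed over i, the first term on the right gives at most the defect of v at z; the subtracted
  -- term is a nonnegative gain, positive wherever u i has no contact.
  have hterm (z : natExt M) (i : ι) : t i * (((u i).fn (proj z) - (u i).fn (tau z)) -
      (v.fn (proj z) - v.fn (tau z))) ≤ e i * (A z - minValue A - (v.fn (proj z) - v.fn (tau z))) -
        t i * (A z - minValue A - ((u i).fn (proj z) - (u i).fn (tau z))) := by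
    have := mul_le_mul_of_nonneg_right (hte i) (sub_nonneg.2 (v.isSubaction z))
    linarith
  have hpos (z : natExt M) (i : ι) :
      0 ≤ t i * (A z - minValue A - ((u i).fn (proj z) - (u i).fn (tau z))) :=
    mul_nonneg (ht0 i).le (sub_nonneg.2 ((u i).isSubaction z))
  have hSz (z : natExt M) : S * (A z - minValue A - (v.fn (proj z) - v.fn (tau z))) ≤
      A z - minValue A - (v.fn (proj z) - v.fn (tau z)) :=
    mul_le_of_le_one_left (sub_nonneg.2 (v.isSubaction z)) hS1
  refine ⟨⟨v.fn + g, ?_, fun z => ?_⟩, fun i W hi z hz => ?_⟩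
  · obtain ⟨C, hC⟩ := v.isHolder
    obtain ⟨C', hC'⟩ := hholder
    refine ⟨C + C', fun x x' => ?_⟩
    have h3 : (v.fn + g) x - (v.fn + g) x' = (v.fn x - v.fn x') + (g x - g x') := by
      simp only [ContinuousMap.add_apply]
      ring
    rw [h3, add_mul]
    exact (abs_add_le _ _).trans (add_le_add (hC x x') (hC' x x'))
  · have h := hasSum_le (fun i => (hterm z i).trans (sub_le_self _ (hpos z i))) (hg z)
      (hS.mul_right _)
    simp only [ContinuousMap.add_apply]
    linarith [hSz z]
  · have h := hasSum_lt (fun i => (hterm z i).trans (sub_le_self _ (hpos z i)))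
      ((hterm z i).trans_lt (sub_lt_self _ (mul_pos (ht0 i) (sub_pos.2 (hi z hz))))) (hg z)
      (hS.mul_right _)
    simp only [ContinuousMap.add_apply]
    linarith [hSz z]

end HolderSubaction

end HolonomicModel

end

/-! ### The theorem. -/

theorem theorem3p4 (s : ℕ) (hs : 0 < s) (M : Matrix (Fin s) (Fin s) ℤ)
    (hM01 : ∀ i j, M i j = 0 ∨ M i j = 1) (hMirr : M.IsIrreducible)
    (lam : Set.Ioo (0 : ℝ) 1) (θ : ℝ) (hθ : 0 < θ)
    (A : HolonomicModel.natExt M → ℝ)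
    (hA : HolonomicModel.IsHolder (HolonomicModel.extDist lam.1) θ A) :
    (∃ u : C(HolonomicModel.sft M, ℝ),
      HolonomicModel.IsHolder (HolonomicModel.sftDist lam.1) θ u ∧
        HolonomicModel.IsSeparating lam.1 A u) ∧
    {u : HolonomicModel.HolderSubaction lam θ A |
      HolonomicModel.IsSeparating lam.1 A u.fn} ∈
        residual (HolonomicModel.HolderSubaction lam θ A) := by
  open HolonomicModel in
  obtain ⟨h0, h1⟩ := lam.2
  have hAc := hA.continuous_natExt h0 h1 hθ
  have hsurj := proj_surjective hM01 hMirr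
  have hc : IsHolder (extDist lam.1) θ fun z => A z - minValue A := by
    obtain ⟨C, hC⟩ := hA
    exact ⟨C, fun z z' => by simpa using hC z z'⟩
  obtain ⟨B, hB⟩ := (isCompact_univ (X := natExt M)).exists_bound_of_continuousOn hAc.continuousOn
  obtain ⟨K, hK⟩ := exists_forall_neg_le_reach hM01 hMirr h0 h1 hθ hc fun x n r hn hr =>
    reach_loop_nonneg hsurj (fun z => hB z (Set.mem_univ z)) hn hr
  obtain ⟨v, hv, hvs, -⟩ := exists_envelope (f := 0) h0 h1 hθ hc hK
    ⟨0, fun x x' => by simp⟩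
  let V : HolderSubaction lam θ A := ⟨v, hv, hvs⟩
  -- This countable family is fixed by v alone and covers the complement of Ω(A), so the same
  -- conditions test every u.
  let good := {p | ReturnsCostly (fun z => A z - minValue A) v (wordCylinder M p)}
  have hstrict (p : good) : ∃ u, u ∈ strictOver lam θ A (wordCylinder M p.1) := by
    obtain ⟨u, hu, hus, hlt⟩ := exists_strict_of_returnsCostly h0 h1 hθ hc hK hv hvs p.2
    exact ⟨⟨u, hu, hus⟩, hlt⟩
  have hsep (u : HolderSubaction lam θ A)
      (hu : ∀ p : good, u ∈ strictOver lam θ A (wordCylinder M p.1)) :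
      IsSeparating lam.1 A u.fn := by
    refine ⟨u.isSubaction, Set.Subset.antisymm ?_
      (nonWandering_subset_proj_contactLocus h0 h1 hAc u.isSubaction)⟩
    rintro _ ⟨z, hz, rfl⟩
    by_contra hzn
    obtain ⟨p, hp, hret⟩ := exists_returnsCostly hsurj h0 h1 hθ hv hvs hzn
    exact (hu ⟨p, hret⟩ z hp).ne hz
  constructor
  · choose u hu using hstrict
    obtain ⟨w, hw⟩ := exists_forall_mem_strictOver hθ V u
    exact ⟨w.fn, w.isHolder, hsep w fun p => hw p _ (hu p)⟩
  · refine mem_of_superset (countable_iInter_mem.2 fun p : good => ?_) fun u hu =>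
      hsep u fun p => Set.mem_iInter.1 hu p
    exact residual_of_dense_open (isOpen_strictOver hAc (isClosed_wordCylinder _))
      (dense_strictOver (hstrict p))
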